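/- Let $K$ be a compact connected subset of the Riemann sphere $\overline{\mathbb C}=\mathbb C\cup\{\infty\}$ that is full, i.e. $\Omega=\overline{\mathbb C}\setminus K$ is connected. Let $d_P$ be the Poincaré distance of $\Omega$: the distance of the complete conformal metric of curvature $-1$ on $\Omega$, or equivalently $$d_P(z,w)=\inf\{d_{\mathbb H}(a,b) : f:\mathbb H\to\Omega \text{ holomorphic},\ f(a)=z,\ f(b)=w\},$$ where $d_{\mathbb H}$ is the hyperbolic distance of the upper half plane $\mathbb H$ (when $K$ is a single point there is no such metric, and $d_P$ is understood as this infimum). Let $l:\overline{\mathbb C}\to\overline{\mathbb C}$ be a homeomorphism such that - $l(z)=z$ for all $z\in K$; - there is a constant $M$ with $d_P(l(z),z)\le M$ for all $z\in\Omega$. Then $l$ is (real) differentiable at Lebesgue almost every point of $K$. More precisely, $l$ is differentiable with $D_zl=\mathrm{id}$ at every Lebesgue density point $z\in K$, that is, at every $z\in K$ with $$\lim_{r\to0}\frac{\lambda(B(z,r)\cap K)}{\lambda(B(z,r))}=1,$$ where $\lambda$ is the planar Lebesgue measure (at $z=\infty$, the density and the derivative are taken in the coordinate $1/z$). -/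

import Mathlib

open Set Filter Topology MeasureTheory
open scoped Manifold UpperHalfPlane NNReal

noncomputable section

/-- The Riemann sphere `ℂ ∪ {∞}`. -/
abbrev RiemannSphere : Type := OnePoint ℂ

namespace RiemannSphere

/-- The inversion `z ↦ 1 / z` of the sphere, exchanging `0` and `∞`. -/
def invFun : RiemannSphere → RiemannSphere
  | OnePoint.infty => ((0 : ℂ) : RiemannSphere)
  | OnePoint.some z => if z = 0 then OnePoint.infty else ((z⁻¹ : ℂ) : RiemannSphere)

@[simp] lemma invFun_infty : invFun OnePoint.infty = ((0 : ℂ) : RiemannSphere) := rfl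

lemma invFun_coe (z : ℂ) :
    invFun (z : RiemannSphere) = if z = 0 then OnePoint.infty else ((z⁻¹ : ℂ) : RiemannSphere) := rfl

lemma invFun_invFun (z : RiemannSphere) : invFun (invFun z) = z := by
  induction z using OnePoint.rec with
  | infty => simp [invFun_coe]
  | coe z =>
    by_cases hz : z = 0
    · simp [invFun_coe, hz]
    · simp [invFun_coe, hz]

lemma continuous_invFun : Continuous invFun := by
  have hinv : Tendsto (fun z : ℂ => ((z⁻¹ : ℂ) : RiemannSphere)) (𝓝[≠] 0) (𝓝 OnePoint.infty) := by
    refine OnePoint.tendsto_coe_infty.comp ?_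
    rw [coclosedCompact_eq_cocompact, ← Metric.cobounded_eq_cocompact]
    exact tendsto_inv₀_nhdsNE_zero
  rw [OnePoint.continuous_iff]
  constructor
  · rw [coclosedCompact_eq_cocompact, ← Metric.cobounded_eq_cocompact]
    have h : Tendsto (fun z : ℂ => ((z⁻¹ : ℂ) : RiemannSphere)) (Bornology.cobounded ℂ)
        (𝓝 ((0 : ℂ) : RiemannSphere)) :=
      (OnePoint.continuous_coe.tendsto _).comp tendsto_inv₀_cobounded
    refine h.congr' ?_
    have h0 : ∀ᶠ z in Bornology.cobounded ℂ, z ≠ 0 :=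
      Bornology.eventually_ne_cobounded 0
    filter_upwards [h0] with z hz
    simp [invFun_coe, hz]
  · rw [continuous_iff_continuousAt]
    intro z
    by_cases hz : z = 0
    · subst hz
      rw [ContinuousAt, ← nhdsNE_sup_pure, tendsto_sup]
      constructor
      · have : invFun ((0 : ℂ) : RiemannSphere) = OnePoint.infty := by simp [invFun_coe]
        rw [this]
        refine hinv.congr' ?_
        filter_upwards [self_mem_nhdsWithin] with z hz
        have hz' : z ≠ 0 := hz
        simp [invFun_coe, hz']
      · exact tendsto_pure_nhds _ _
    · have h : ContinuousAt (fun z : ℂ => ((z⁻¹ : ℂ) : RiemannSphere)) z :=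
        OnePoint.continuous_coe.continuousAt.comp (continuousAt_inv₀ hz)
      refine h.congr ?_
      filter_upwards [isOpen_ne.mem_nhds hz] with w hw
      have hw' : w ≠ 0 := hw
      simp [invFun_coe, hw']

/-- The inversion as a homeomorphism of the sphere. -/
def inversion : RiemannSphere ≃ₜ RiemannSphere where
  toFun := invFun
  invFun := invFun
  left_inv := invFun_invFun
  right_inv := invFun_invFun
  continuous_toFun := continuous_invFun
  continuous_invFun := continuous_invFun

/-- The affine chart `z ↦ z`, defined off `∞`. -/
def affineChart : OpenPartialHomeomorph RiemannSphere ℂ :=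
  (OnePoint.isOpenEmbedding_coe.toOpenPartialHomeomorph ((↑) : ℂ → RiemannSphere)).symm

/-- The chart `z ↦ 1 / z`, defined off `0`. -/
def chartAtInfty : OpenPartialHomeomorph RiemannSphere ℂ :=
  inversion.transOpenPartialHomeomorph affineChart

@[simp] lemma affineChart_symm_apply (z : ℂ) : affineChart.symm z = (z : RiemannSphere) := rfl

@[simp] lemma affineChart_target : affineChart.target = univ := rfl

lemma affineChart_source : affineChart.source = {OnePoint.infty}ᶜ := by
  rw [OnePoint.compl_infty]
  simp [affineChart]

@[simp] lemma affineChart_coe (z : ℂ) : affineChart (z : RiemannSphere) = z :=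
  affineChart.right_inv (mem_univ z)

@[simp] lemma chartAtInfty_apply (z : RiemannSphere) :
    chartAtInfty z = affineChart (invFun z) := rfl

@[simp] lemma chartAtInfty_symm_apply (w : ℂ) :
    chartAtInfty.symm w = invFun (w : RiemannSphere) := rfl

@[simp] lemma chartAtInfty_target : chartAtInfty.target = univ := rfl

lemma chartAtInfty_source : chartAtInfty.source = invFun ⁻¹' {OnePoint.infty}ᶜ := by
  rw [← affineChart_source]; rfl

lemma mem_chartAtInfty_source {z : RiemannSphere} :
    z ∈ chartAtInfty.source ↔ z ≠ ((0 : ℂ) : RiemannSphere) := by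
  rw [chartAtInfty_source, mem_preimage, mem_compl_iff, mem_singleton_iff, not_iff_not]
  constructor
  · intro h
    rw [← invFun_invFun z, h, invFun_infty]
  · rintro rfl
    simp [invFun_coe]

/-- The standard atlas of the sphere: the chart `z` is the preferred one at finite points, and
`1 / z` is the preferred one at `∞`. -/
instance : ChartedSpace ℂ RiemannSphere where
  atlas := {affineChart, chartAtInfty}
  chartAt := fun z => OnePoint.elim z chartAtInfty (fun _ => affineChart)
  mem_chart_source := by
    intro z
    induction z using OnePoint.rec with
    | infty => exact mem_chartAtInfty_source.2 (OnePoint.infty_ne_coe 0)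
    | coe z => rw [OnePoint.elim_some, affineChart_source]; simp
  chart_mem_atlas := by
    intro z
    induction z using OnePoint.rec with
    | infty => simp
    | coe z => simp

lemma chartAt_coe (z : ℂ) : chartAt ℂ (z : RiemannSphere) = affineChart := rfl

lemma chartAt_infty : chartAt ℂ (OnePoint.infty : RiemannSphere) = chartAtInfty := rfl

lemma affineChart_invFun_coe (w : ℂ) (hw : w ≠ 0) :
    affineChart (invFun (w : RiemannSphere)) = w⁻¹ := by
  rw [invFun_coe, if_neg hw, affineChart_coe]

/-- The sphere is a complex analytic manifold. -/
instance : IsManifold 𝓘(ℂ) ⊤ RiemannSphere := by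
  have key : ContDiffOn ℂ ⊤ (fun w : ℂ => affineChart (invFun (w : RiemannSphere))) {0}ᶜ := by
    refine ContDiffOn.congr (f := fun w : ℂ => w⁻¹) ?_ (fun w hw => affineChart_invFun_coe w hw)
    exact fun w hw => (contDiffAt_inv ℂ hw).contDiffWithinAt
  have hself : ∀ w : ℂ, affineChart (w : RiemannSphere) = w := affineChart_coe
  refine isManifold_of_contDiffOn _ _ _ ?_
  intro e e' he he'
  change e = affineChart ∨ e = chartAtInfty at he
  change e' = affineChart ∨ e' = chartAtInfty at he'
  rcases he with rfl | rfl <;> rcases he' with rfl | rfl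
  · refine contDiffOn_id.congr ?_
    intro w _
    simp
  · refine (key.mono ?_).congr ?_
    · intro w hw
      simp [mem_chartAtInfty_source] at hw
      simpa using hw
    · intro w _
      simp
  · refine (key.mono ?_).congr ?_
    · intro w hw
      simp [affineChart_source] at hw
      intro h0
      apply hw
      rw [mem_singleton_iff.1 h0]
      simp [invFun_coe]
    · intro w _
      simp
  · refine contDiffOn_id.congr ?_
    intro w _
    simp [invFun_invFun]

/-- `z` is a Lebesgue density point of `K`: in the preferred chart at `z` (the affine coordinate
if `z` is finite, the coordinate `1 / z` if `z = ∞`),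
`λ (B(z, r) ∩ K) / λ (B(z, r)) → 1` as `r → 0`. -/
def IsLebesgueDensityPoint (K : Set RiemannSphere) (z : RiemannSphere) : Prop :=
  Tendsto (fun r : ℝ =>
      volume (Metric.ball (chartAt ℂ z z) r ∩ (chartAt ℂ z).symm ⁻¹' K) /
        volume (Metric.ball (chartAt ℂ z z) r))
    (𝓝[>] 0) (𝓝 1)

/-- The Poincaré distance of an open set `Ω` of the sphere (curvature `-1`, as on `ℍ`): the
infimum of the hyperbolic distances `dist a b` over all holomorphic maps `f : ℍ → Ω` with
`f a = z` and `f b = w`. On a hyperbolic domain every `f` lifts to the universal cover `ℍ → Ω`,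
so by the Schwarz–Pick lemma this is the distance induced by the hyperbolic metric;
`poincareEDist_eq_of_biholomorphic` below records this for a simply connected `Ω`, where
the distance is the image of that of `ℍ` under any conformal representation `ℍ → Ω`. -/
def poincareEDist (Ω : Set RiemannSphere) (z w : RiemannSphere) : ENNReal :=
  ⨅ (f : ℍ → RiemannSphere) (_ : MDifferentiable 𝓘(ℂ) 𝓘(ℂ) f) (_ : ∀ τ, f τ ∈ Ω)
    (a : ℍ) (b : ℍ) (_ : f a = z) (_ : f b = w), edist a b

/-- The **Schwarz–Pick lemma** on the upper half plane. -/
theorem dist_le_of_mdifferentiable {f : ℍ → ℍ} (hf : MDifferentiable 𝓘(ℂ) 𝓘(ℂ) f) (a b : ℍ) :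
    dist (f a) (f b) ≤ dist a b := by
  -- the Cayley transform centred at `a`, and its inverse
  let φ : ℂ → ℂ := fun ζ => (a - (starRingEnd ℂ) (a : ℂ) * ζ) / (1 - ζ)
  have hne : ∀ ζ ∈ Metric.ball (0 : ℂ) 1, 1 - ζ ≠ 0 := by
    intro ζ hζ h
    rw [mem_ball_zero_iff, ← sub_eq_zero.1 h] at hζ
    simp at hζ
  have him : ∀ ζ ∈ Metric.ball (0 : ℂ) 1, 0 < (φ ζ).im := by
    intro ζ hζ
    have hn : 0 < Complex.normSq (1 - ζ) := Complex.normSq_pos.2 (hne ζ hζ)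
    have h1 : ζ.re * ζ.re + ζ.im * ζ.im < 1 := by
      rw [← Complex.normSq_apply, Complex.normSq_eq_norm_sq]
      rw [mem_ball_zero_iff] at hζ
      nlinarith [norm_nonneg ζ]
    have : (φ ζ).im = (a : ℂ).im * (1 - (ζ.re * ζ.re + ζ.im * ζ.im)) / Complex.normSq (1 - ζ) := by
      simp only [φ, Complex.div_im]
      field_simp
      simp
      ring
    rw [this]
    exact div_pos (mul_pos a.im_pos (by linarith)) hn
  have hφd : DifferentiableOn ℂ φ (Metric.ball 0 1) := by
    intro ζ hζ
    have := hne ζ hζ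
    exact ((by fun_prop : DifferentiableAt ℂ (fun ζ : ℂ => (a : ℂ) - (starRingEnd ℂ) (a : ℂ) * ζ) ζ).div
      (by fun_prop) this).differentiableWithinAt
  let F : ℂ → ℂ := fun w => (f (UpperHalfPlane.ofComplex w) : ℂ)
  have hF : DifferentiableOn ℂ F {z | 0 < z.im} :=
    UpperHalfPlane.mdifferentiable_iff.1 (UpperHalfPlane.mdifferentiable_coe.comp hf)
  let c : ℍ := f a
  have hden : ∀ w : ℍ, (w : ℂ) - (starRingEnd ℂ) (c : ℂ) ≠ 0 := by
    intro w h
    have h' := congrArg Complex.im h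
    simp at h'
    have h1 := w.im_pos
    have h2 := c.im_pos
    linarith
  let g : ℂ → ℂ := fun ζ => (F (φ ζ) - c) / (F (φ ζ) - (starRingEnd ℂ) (c : ℂ))
  have hg : DifferentiableOn ℂ g (Metric.ball 0 1) := by
    have h := hF.comp hφd him
    exact (h.sub_const _).div (h.sub_const _) (fun ζ _ => hden _)
  have hgn : ∀ w : ℍ, ‖((w : ℂ) - c) / ((w : ℂ) - (starRingEnd ℂ) (c : ℂ))‖
      = Real.tanh (dist w c / 2) := by
    intro w
    rw [UpperHalfPlane.tanh_half_dist, norm_div, Complex.dist_eq, Complex.dist_eq]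
  have hmaps : MapsTo g (Metric.ball 0 1) (Metric.closedBall 0 1) := by
    intro ζ _
    rw [mem_closedBall_zero_iff]
    exact ((hgn _).trans_lt (Real.tanh_lt_one _)).le
  have hφ0 : φ 0 = a := by simp [φ]
  have hg0 : g 0 = 0 := by simp [g, F, hφ0, c]
  have hab : (b : ℂ) - (starRingEnd ℂ) (a : ℂ) ≠ 0 := by
    intro h
    have h' := congrArg Complex.im h
    simp at h'
    have h1 := b.im_pos
    have h2 := a.im_pos
    linarith
  let ζ : ℂ := ((b : ℂ) - a) / ((b : ℂ) - (starRingEnd ℂ) (a : ℂ))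
  have hζn : ‖ζ‖ = Real.tanh (dist b a / 2) := by
    rw [UpperHalfPlane.tanh_half_dist, norm_div, Complex.dist_eq, Complex.dist_eq]
  have hζ : ‖ζ‖ < 1 := hζn.trans_lt (Real.tanh_lt_one _)
  have hφζ : φ ζ = b := by
    have h1 : 1 - ζ ≠ 0 := hne ζ (mem_ball_zero_iff.2 hζ)
    simp only [φ]
    rw [div_eq_iff h1]
    simp only [ζ]
    field_simp
    ring
  have hgζ : ‖g ζ‖ = Real.tanh (dist (f b) (f a) / 2) := by
    simp only [g, F, hφζ, UpperHalfPlane.ofComplex_apply]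
    exact hgn (f b)
  have key := Complex.norm_le_norm_of_mapsTo_ball hg hmaps hg0 hζ
  rw [hgζ, hζn] at key
  have := Real.artanh_le_artanh (Real.neg_one_lt_tanh _) (Real.tanh_lt_one _) key
  rw [Real.artanh_tanh, Real.artanh_tanh, dist_comm (f b), dist_comm b] at this
  linarith

/-- If `φ : ℍ → Ω` is a biholomorphic map, with inverse `ψ`, then the Poincaré distance of `Ω` is
the image under `φ` of the hyperbolic distance of `ℍ` (surjectivity of `φ` is not even needed). -/
theorem poincareEDist_eq_of_biholomorphic {Ω : Set RiemannSphere} (hΩ : IsOpen Ω)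
    {φ : ℍ → RiemannSphere} {ψ : RiemannSphere → ℍ}
    (hφ : MDifferentiable 𝓘(ℂ) 𝓘(ℂ) φ) (hφΩ : ∀ τ, φ τ ∈ Ω)
    (hψ : MDifferentiableOn 𝓘(ℂ) 𝓘(ℂ) ψ Ω) (hψφ : ∀ τ, ψ (φ τ) = τ) (a b : ℍ) :
    poincareEDist Ω (φ a) (φ b) = edist a b := by
  apply le_antisymm
  · exact iInf₂_le_of_le φ hφ <| iInf₂_le_of_le hφΩ a <| iInf₂_le_of_le b rfl <|
      iInf_le_of_le rfl le_rfl
  · simp only [poincareEDist, le_iInf_iff]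
    intro f hf hfΩ p q hp hq
    have hcomp : MDifferentiable 𝓘(ℂ) 𝓘(ℂ) (ψ ∘ f) := fun τ =>
      ((hψ (f τ) (hfΩ τ)).mdifferentiableAt (hΩ.mem_nhds (hfΩ τ))).comp τ (hf τ)
    have h := dist_le_of_mdifferentiable hcomp p q
    simp only [Function.comp_apply, hp, hq, hψφ] at h
    rw [edist_dist, edist_dist]
    exact ENNReal.ofReal_le_ofReal h

end RiemannSphere

end

/-!
Near a density point `x` of `K`, every point `z` outside `K` is surrounded by points of `K` at
distance `o(‖z - x‖)`. The homeomorphism moves `z` by a bounded Poincaré distance, so it suffices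
that a bounded Poincaré distance from `z` forces a Euclidean distance `o(‖z - x‖)`; then
`l z - z = o(‖z - x‖)`, which is differentiability with derivative the identity.

The comparison of distances needs only three points of `K`: the density point `x` itself, and two
points `p`, `q` on either side of `z`, at distances comparable to `ε * ‖z - x‖` from `z` and from
each other; they exist by `eventually_forall_exists_mem_dist_lt_of_density`. The Möbius map `T`
sending `p`, `q`, `x` to `0`, `1`, `∞` has `‖T z‖` between `1 / 4` and `1`. If `f` is a holomorphic
map from the upper half plane to the complement of `K`, then `T ∘ f` is a holomorphic function
omitting `0` and `1`, so Schottky's theorem (`RiemannSphere.exists_schottky_bound_upperHalfPlane`)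
bounds `‖T w‖` at every point `w` reached from `z` within a bounded hyperbolic distance. Undoing `T`
gives `‖w - z‖ ≤ C * ε * ‖z - x‖`; this is
`RiemannSphere.exists_norm_sub_le_of_poincareEDist_le`.

Schottky's theorem is obtained by Landau's method: a function `F` omitting `0` and `1` on a disc is
`exp (2πi cosh² h)` for a holomorphic `h` that omits every point where `cosh²` is a natural number.
These points form a net in the plane (`exists_cosh_sq_eq_natCast_norm_sub_le`), so the image of `h`
contains no large disc, and Bloch's theorem (`exists_ball_subset_image_of_closedBall_subset`) bounds
the derivative of `h`, hence `h` and `F`.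

The point at infinity is treated by conjugating with the inversion, and the almost everywhere
statement follows from the Lebesgue density theorem.
-/

/-! ### Bloch's theorem -/

/-- **Bloch's theorem**: the image of a holomorphic function contains a disc whose radius is
controlled from below by the derivative at the centre of a disc in the domain. -/
theorem exists_ball_subset_image_of_closedBall_subset {h : ℂ → ℂ} {U : Set ℂ} (hU : IsOpen U)
    (hd : DifferentiableOn ℂ h U) {c : ℂ} {R : ℝ} (hR : 0 < R) (hRU : Metric.closedBall c R ⊆ U) :
    ∃ w, Metric.ball w (R * ‖deriv h c‖ / 48) ⊆ h '' U := by
  rcases eq_or_ne (deriv h c) 0 with h0 | h0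
  · exact ⟨0, by simp [h0]⟩
  have hd' : DifferentiableOn ℂ (deriv h) U := hd.deriv hU
  -- `a` maximizes `‖h' z‖ * (R - ‖z - c‖)`, so `‖h'‖ ≤ 2 * ‖h' a‖` on the ball of radius `t` below
  obtain ⟨a, haR, hamax⟩ := (isCompact_closedBall c R).exists_isMaxOn
    (f := fun z => ‖deriv h z‖ * (R - dist z c)) ⟨c, by simp [hR.le]⟩
    ((hd'.continuousOn.mono hRU).norm.mul (by fun_prop))
  have hmax : ∀ z ∈ Metric.closedBall c R,
      ‖deriv h z‖ * (R - dist z c) ≤ ‖deriv h a‖ * (R - dist a c) := fun z hz => hamax hz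
  have hc := hmax c (by simp [hR.le])
  simp only [dist_self, sub_zero] at hc
  have hpos : 0 < ‖deriv h a‖ * (R - dist a c) :=
    (mul_pos (norm_pos_iff.2 h0) hR).trans_le hc
  set D := ‖deriv h a‖ with hD
  have hac : dist a c ≤ R := haR
  have hDpos : 0 < D := pos_of_mul_pos_left hpos (by linarith)
  have htpos : 0 < R - dist a c := pos_of_mul_pos_right hpos hDpos.le
  set t := (R - dist a c) / 2 with ht
  have ht0 : 0 < t := by positivity
  have hball : ∀ z ∈ Metric.ball a t, z ∈ Metric.closedBall c R ∧ t ≤ R - dist z c := by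
    intro z hz
    rw [Metric.mem_ball] at hz
    have := dist_triangle z a c
    constructor
    · rw [Metric.mem_closedBall]; linarith
    · linarith
  have hbound : ∀ z ∈ Metric.ball a t, ‖deriv h z‖ ≤ 2 * D := by
    intro z hz
    obtain ⟨hz1, hz2⟩ := hball z hz
    have h1 := hmax z hz1
    have h2 : ‖deriv h z‖ * t ≤ ‖deriv h z‖ * (R - dist z c) := by gcongr
    have h3 : ‖deriv h z‖ * t ≤ (2 * D) * t := by
      calc _ ≤ _ := h2.trans h1
        _ = _ := by rw [ht]; ring
    exact le_of_mul_le_mul_right h3 ht0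
  have hsub : Metric.ball a t ⊆ U := fun z hz => hRU (hball z hz).1
  -- the Schwarz lemma, applied to `h' - h' a`
  have hlip : ∀ z ∈ Metric.ball a t, dist (deriv h z) (deriv h a) ≤ 3 * D / t * dist z a := by
    intro z hz
    refine Complex.dist_le_div_mul_dist_of_mapsTo_ball (hd'.mono hsub) ?_ hz
    intro w hw
    rw [Metric.mem_closedBall, dist_eq_norm]
    calc ‖deriv h w - deriv h a‖ ≤ ‖deriv h w‖ + ‖deriv h a‖ := norm_sub_le _ _
      _ ≤ 3 * D := by linarith [hbound w hw]
  have hsmall : Metric.closedBall a (t / 6) ⊆ Metric.ball a t :=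
    Metric.closedBall_subset_ball (by linarith)
  have hmv : ∀ z ∈ Metric.closedBall a (t / 6),
      ‖(h z - deriv h a * z) - (h a - deriv h a * a)‖ ≤ D / 2 * ‖z - a‖ := by
    intro z hz
    refine (convex_closedBall a (t / 6)).norm_image_sub_le_of_norm_hasDerivWithin_le
      (f := fun z => h z - deriv h a * z) (f' := fun z => deriv h z - deriv h a) ?_ ?_
      (Metric.mem_closedBall_self (by positivity)) hz
    · intro x hx
      have h1 := ((hd x (hsub (hsmall hx))).differentiableAt
        (hU.mem_nhds (hsub (hsmall hx)))).hasDerivAt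
      have h2 := (h1.sub ((hasDerivAt_id x).const_mul (deriv h a))).hasDerivWithinAt
        (s := Metric.closedBall a (t / 6))
      rw [mul_one] at h2
      exact h2
    · intro x hx
      rw [← dist_eq_norm]
      calc _ ≤ 3 * D / t * dist x a := hlip x (hsmall hx)
        _ ≤ 3 * D / t * (t / 6) := by gcongr; exact hx
        _ = D / 2 := by field_simp; norm_num
  -- on the circle of radius `t / 6` the linear part of `h` dominates the error
  have hsphere : ∀ z ∈ Metric.sphere a (t / 6), D * t / 12 ≤ ‖h z - h a‖ := by
    intro z hz
    have hza : ‖z - a‖ = t / 6 := by rw [← dist_eq_norm]; exact hz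
    have h1 := hmv z (Metric.sphere_subset_closedBall hz)
    have h2 : ‖deriv h a * (z - a)‖ = D * (t / 6) := by rw [norm_mul, hza]
    have h3 : deriv h a * (z - a)
        = (h z - h a) - ((h z - deriv h a * z) - (h a - deriv h a * a)) := by ring
    have h4 := norm_sub_le (h z - h a) ((h z - deriv h a * z) - (h a - deriv h a * a))
    rw [← h3, h2] at h4
    rw [hza] at h1
    linarith
  have hcl : DiffContOnCl ℂ h (Metric.ball a (t / 6)) := by
    apply DifferentiableOn.diffContOnCl
    rw [closure_ball a (by positivity)]
    exact hd.mono (hsmall.trans hsub)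
  have hne : ∃ᶠ z in 𝓝 a, h z ≠ h a := by
    intro hev
    have hev' : h =ᶠ[𝓝 a] fun _ => h a := hev.mono fun z hz => not_not.1 hz
    have := hev'.deriv_eq
    rw [deriv_const] at this
    rw [hD, this, norm_zero] at hDpos
    exact lt_irrefl _ hDpos
  refine ⟨h a, ?_⟩
  calc Metric.ball (h a) (R * ‖deriv h c‖ / 48)
      ⊆ Metric.ball (h a) (D * t / 12 / 2) := by
        apply Metric.ball_subset_ball
        rw [ht]
        linarith
    _ ⊆ h '' Metric.closedBall a (t / 6) :=
        hcl.ball_subset_image_closedBall (by positivity) hsphere hne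
    _ ⊆ h '' U := image_mono (hsmall.trans hsub)

/-! ### Schottky's theorem -/

/-- A zero-free holomorphic function on a disc has a holomorphic logarithm, which can be chosen
to take the principal value at the centre. -/
theorem exists_exp_eq_of_ne_zero {F : ℂ → ℂ} {c : ℂ} {r : ℝ} (hr : 0 < r)
    (hF : DifferentiableOn ℂ F (Metric.ball c r)) (h0 : ∀ z ∈ Metric.ball c r, F z ≠ 0) :
    ∃ L : ℂ → ℂ, DifferentiableOn ℂ L (Metric.ball c r) ∧ L c = Complex.log (F c) ∧
      ∀ z ∈ Metric.ball c r, Complex.exp (L z) = F z := by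
  have hc : c ∈ Metric.ball c r := Metric.mem_ball_self hr
  have hq : DifferentiableOn ℂ (fun z => deriv F z / F z) (Metric.ball c r) :=
    (hF.deriv Metric.isOpen_ball).div hF h0
  obtain ⟨L, hLc, hL⟩ := hq.isExactOn_ball.with_val_at c (Complex.log (F c))
  refine ⟨L, fun z hz => (hL z hz).differentiableAt.differentiableWithinAt, hLc, ?_⟩
  have hconst : ∀ z ∈ Metric.ball c r, HasDerivAt (fun z => Complex.exp (-L z) * F z) 0 z := by
    intro z hz
    have h1 := ((hF z hz).differentiableAt (Metric.isOpen_ball.mem_nhds hz)).hasDerivAt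
    have h2 := (hL z hz).neg.cexp.mul h1
    convert! h2 using 1
    have := h0 z hz
    field_simp
    ring
  intro z hz
  have hz' := (convex_ball c r).is_const_of_fderivWithin_eq_zero (𝕜 := ℂ)
    (f := fun z => Complex.exp (-L z) * F z)
    (fun x hx => (hconst x hx).differentiableAt.differentiableWithinAt)
    (fun x hx => by
      rw [fderivWithin_of_isOpen Metric.isOpen_ball hx]
      ext
      simpa using (hconst x hx).deriv) hz hc
  simp only [hLc, Complex.exp_neg, Complex.exp_log (h0 c hc), inv_mul_cancel₀ (h0 c hc)] at hz'
  field_simp at hz'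
  exact hz'.symm

/-- The points where `cosh ^ 2` is a natural number form a net in the plane: they are spaced by `π`
vertically, and have gaps of length at most `1` horizontally. -/
theorem exists_cosh_sq_eq_natCast_norm_sub_le (w : ℂ) :
    ∃ (v : ℂ) (n : ℕ), Complex.cosh v ^ 2 = n ∧ ‖v - w‖ ≤ 3 := by
  wlog hw : 0 ≤ w.re generalizing w
  · obtain ⟨v, n, hv, hvw⟩ := this (-w) (by simp; linarith)
    refine ⟨-v, n, by rwa [Complex.cosh_neg], ?_⟩
    rwa [← norm_neg, neg_sub', neg_neg, sub_eq_add_neg]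
  set x := w.re
  -- `cosh ^ 2` grows by at least `1` on `[x, x + 1]`, so it takes an integral value there
  have hgrow : Real.cosh x ^ 2 + 1 ≤ Real.cosh (x + 1) ^ 2 := by
    have h1 : Real.cosh x * (3 / 2) ≤ Real.cosh (x + 1) := by
      rw [Real.cosh_add]
      have h2 : 3 / 2 ≤ Real.cosh 1 := by
        have h4 : (1 / 3 : ℝ) ≤ Real.exp (-1) := by
          rw [Real.exp_neg, one_div]
          exact inv_anti₀ (Real.exp_pos 1) (by linarith [Real.exp_one_lt_d9])
        rw [Real.cosh_eq]
        linarith [Real.exp_one_gt_d9]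
      have h3 : 0 ≤ Real.sinh x * Real.sinh 1 :=
        mul_nonneg (Real.sinh_nonneg_iff.2 hw) (Real.sinh_nonneg_iff.2 zero_le_one)
      nlinarith [Real.cosh_pos x]
    nlinarith [Real.one_le_cosh x]
  obtain ⟨y, hy, hyn⟩ : ∃ y ∈ Icc x (x + 1), Real.cosh y ^ 2 = (⌈Real.cosh x ^ 2⌉₊ : ℝ) := by
    apply intermediate_value_Icc (by linarith : x ≤ x + 1)
      (f := fun y => Real.cosh y ^ 2) (by fun_prop)
    constructor
    · exact Nat.le_ceil _
    · exact (Nat.ceil_lt_add_one (by positivity)).le.trans hgrow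
  set k : ℤ := round (w.im / Real.pi)
  refine ⟨y + k * (Real.pi * Complex.I), ⌈Real.cosh x ^ 2⌉₊, ?_, ?_⟩
  · rw [Complex.cosh_add, mul_left_comm, ← mul_assoc, mul_comm (Real.pi : ℂ),
      Complex.cosh_mul_I, Complex.sinh_mul_I, Complex.sin_int_mul_pi]
    rw [zero_mul, mul_zero, add_zero, mul_pow]
    have : Complex.cos (k * Real.pi) ^ 2 = 1 := by
      have := Complex.sin_sq_add_cos_sq (k * Real.pi)
      rw [Complex.sin_int_mul_pi] at this
      simpa using this
    rw [this, mul_one, ← Complex.ofReal_cosh]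
    exact_mod_cast hyn
  · have hk : |w.im / Real.pi - k| ≤ 1 / 2 := abs_sub_round _
    refine (Complex.norm_le_abs_re_add_abs_im _).trans ?_
    have him : |k * Real.pi - w.im| ≤ 2 := by
      have : (k : ℝ) * Real.pi - w.im = -(w.im / Real.pi - k) * Real.pi := by
        field_simp
        ring
      rw [this, abs_mul, abs_neg, abs_of_pos Real.pi_pos]
      nlinarith [Real.pi_pos, Real.pi_le_four]
    have hre : |y - w.re| ≤ 1 := by
      rw [abs_le]
      constructor <;> linarith [hy.1, hy.2]
    simp
    linarith

theorem abs_log_le_of_exp_le {x b : ℝ} (hx : 0 < x) (h1 : Real.exp (-b) ≤ x) (h2 : x ≤ Real.exp b) :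
    |Real.log x| ≤ b := by
  rw [abs_le]
  exact ⟨(Real.le_log_iff_exp_le hx).2 h1, (Real.log_le_iff_le_exp hx).2 h2⟩

theorem norm_clog_le (z : ℂ) : ‖Complex.log z‖ ≤ |Real.log ‖z‖| + Real.pi := by
  refine (Complex.norm_le_abs_re_add_abs_im _).trans ?_
  rw [Complex.log_re, Complex.log_im]
  gcongr
  exact Complex.abs_arg_le_pi z

theorem norm_ccosh_le (z : ℂ) : ‖Complex.cosh z‖ ≤ Real.exp ‖z‖ := by
  rw [Complex.cosh, norm_div]
  have h1 := norm_add_le (Complex.exp z) (Complex.exp (-z))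
  have h2 := Complex.norm_exp_le_exp_norm z
  have h3 := Complex.norm_exp_le_exp_norm (-z)
  rw [norm_neg] at h3
  norm_num
  linarith

/-- **Schottky's theorem**, for functions omitting `0` and `1` whose value at the centre is
bounded and bounded away from `0`. -/
theorem exists_schottky_bound {ρ : ℝ} (hρ : ρ < 1) :
    ∃ C : ℝ, ∀ F : ℂ → ℂ, DifferentiableOn ℂ F (Metric.ball 0 1) →
      (∀ z ∈ Metric.ball (0 : ℂ) 1, F z ≠ 0) → (∀ z ∈ Metric.ball (0 : ℂ) 1, F z ≠ 1) →
      1 / 4 ≤ ‖F 0‖ → ‖F 0‖ ≤ 1 → ∀ z, ‖z‖ ≤ ρ → ‖F z‖ ≤ C := by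
  refine ⟨Real.exp (8 * Real.exp (6 + 288 / (1 - ρ)) ^ 2), ?_⟩
  intro F hF hF0 hF1 hlow hupp z hz
  have h0mem : (0 : ℂ) ∈ Metric.ball (0 : ℂ) 1 := by simp
  have hπ3 := Real.pi_gt_three
  have hπ4 := Real.pi_le_four
  have hexp1 := Real.exp_one_gt_d9
  have hexp2 : 4 ≤ Real.exp 2 := by
    rw [show (2 : ℝ) = 1 + 1 by norm_num, Real.exp_add]; nlinarith
  have hexpn2 : Real.exp (-2) ≤ 1 / 4 := by
    rw [Real.exp_neg, one_div]; exact inv_anti₀ (by norm_num) hexp2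
  -- `F = exp (2πi g)`, and `g` omits the integers
  obtain ⟨L, hL, hL0, hLF⟩ := exists_exp_eq_of_ne_zero one_pos hF hF0
  set g : ℂ → ℂ := fun z => L z / (2 * Real.pi * Complex.I) with hg
  have h2pi : (2 * Real.pi * Complex.I : ℂ) ≠ 0 := Complex.two_pi_I_ne_zero
  have hn2pi : ‖(2 * Real.pi * Complex.I : ℂ)‖ = 2 * Real.pi := by
    simp [abs_of_pos Real.pi_pos]
  have hLg : ∀ z, L z = g z * (2 * Real.pi * Complex.I) := fun z => by
    rw [hg]; field_simp
  have hgd : DifferentiableOn ℂ g (Metric.ball 0 1) := hL.div_const _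
  have hgnat : ∀ z ∈ Metric.ball (0 : ℂ) 1, ∀ n : ℕ, g z ≠ n := by
    intro z hz n hn
    apply hF1 z hz
    rw [← hLF z hz, hLg, hn]
    exact_mod_cast Complex.exp_nat_mul_two_pi_mul_I n
  have hg0 : ‖g 0‖ ≤ 1 := by
    rw [hg, norm_div, hn2pi, div_le_one (by positivity), hL0]
    refine (norm_clog_le _).trans ?_
    have := abs_log_le_of_exp_le (b := 2) (by linarith : 0 < ‖F 0‖) (by linarith) (by linarith)
    linarith
  -- `g = cosh² h`
  -- (with `u ^ 2 = g` and `v ^ 2 = g - 1`, the function `u - v` has inverse `u + v`)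
  obtain ⟨lu, hlu, -, hexplu⟩ := exists_exp_eq_of_ne_zero one_pos hgd
    (fun z hz => by simpa using hgnat z hz 0)
  obtain ⟨lv, hlv, -, hexplv⟩ := exists_exp_eq_of_ne_zero one_pos (hgd.sub_const 1)
    (fun z hz => by simpa [sub_eq_zero] using hgnat z hz 1)
  set u : ℂ → ℂ := fun z => Complex.exp (lu z / 2) with hu
  set v : ℂ → ℂ := fun z => Complex.exp (lv z / 2) with hv
  have hu2 : ∀ z ∈ Metric.ball (0 : ℂ) 1, u z ^ 2 = g z := by
    intro z hz
    rw [hu, ← hexplu z hz, ← Complex.exp_nat_mul]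
    congr 1; push_cast; ring
  have hv2 : ∀ z ∈ Metric.ball (0 : ℂ) 1, v z ^ 2 = g z - 1 := by
    intro z hz
    rw [hv, ← hexplv z hz, ← Complex.exp_nat_mul]
    congr 1; push_cast; ring
  have huv : ∀ z ∈ Metric.ball (0 : ℂ) 1, (u z - v z) * (u z + v z) = 1 := by
    intro z hz
    linear_combination hu2 z hz - hv2 z hz
  have huvne : ∀ z ∈ Metric.ball (0 : ℂ) 1, u z - v z ≠ 0 := fun z hz =>
    left_ne_zero_of_mul_eq_one (huv z hz)
  obtain ⟨h, hh, hh0, hexph⟩ := exists_exp_eq_of_ne_zero one_pos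
    (((hlu.div_const 2).cexp).sub ((hlv.div_const 2).cexp)) huvne
  have hcosh : ∀ z ∈ Metric.ball (0 : ℂ) 1, Complex.cosh (h z) ^ 2 = g z := by
    intro z hz
    have h1 : Complex.exp (h z) = u z - v z := hexph z hz
    have h2 : Complex.exp (-h z) = u z + v z := by
      rw [Complex.exp_neg, h1]
      exact inv_eq_of_mul_eq_one_right (huv z hz)
    rw [Complex.cosh, h1, h2, ← hu2 z hz]
    ring
  -- the initial value of `h` is bounded
  have hh0' : ‖h 0‖ ≤ 6 := by
    have hu0 : ‖u 0‖ ≤ 3 / 2 := by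
      have h1 : ‖u 0‖ ^ 2 ≤ 1 := by rw [← norm_pow, hu2 0 h0mem]; exact hg0
      nlinarith [norm_nonneg (u 0)]
    have hv0 : ‖v 0‖ ≤ 3 / 2 := by
      have h1 : ‖v 0‖ ^ 2 ≤ 2 := by
        rw [← norm_pow, hv2 0 h0mem]
        refine (norm_sub_le _ _).trans ?_
        simp; linarith
      nlinarith [norm_nonneg (v 0)]
    have hsub := norm_sub_le (u 0) (v 0)
    have hadd := norm_add_le (u 0) (v 0)
    have hmul : ‖u 0 - v 0‖ * ‖u 0 + v 0‖ = 1 := by rw [← norm_mul, huv 0 h0mem, norm_one]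
    have hpos : 0 < ‖u 0 - v 0‖ := norm_pos_iff.2 (huvne 0 h0mem)
    have hlow' : 1 / 3 ≤ ‖u 0 - v 0‖ := by nlinarith
    rw [hh0]
    refine (norm_clog_le _).trans ?_
    have := abs_log_le_of_exp_le (b := 2) hpos (by linarith) (by linarith)
    have h314 := Real.pi_lt_d2
    change |Real.log ‖u 0 - v 0‖| + Real.pi ≤ 6
    linarith
  -- `h` omits a net, so Bloch's theorem bounds its derivative
  have hderiv : ∀ ζ ∈ Metric.closedBall (0 : ℂ) ρ, ‖deriv h ζ‖ ≤ 288 / (1 - ρ) := by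
    intro ζ hζ
    have hR : 0 < (1 - ρ) / 2 := by linarith
    have hsub : Metric.closedBall ζ ((1 - ρ) / 2) ⊆ Metric.ball 0 1 :=
      (Metric.closedBall_subset_closedBall' (ε₂ := (1 + ρ) / 2) (y := 0)
        (by rw [Metric.mem_closedBall] at hζ; linarith)).trans
        (Metric.closedBall_subset_ball (by linarith))
    obtain ⟨w, hw⟩ := exists_ball_subset_image_of_closedBall_subset Metric.isOpen_ball hh hR hsub
    obtain ⟨p, n, hp, hpw⟩ := exists_cosh_sq_eq_natCast_norm_sub_le w
    have hle : (1 - ρ) / 2 * ‖deriv h ζ‖ / 48 ≤ 3 := by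
      by_contra! hlt
      obtain ⟨ξ, hξ, hξp⟩ := hw (by rw [Metric.mem_ball, dist_eq_norm]; linarith : p ∈ _)
      exact hgnat ξ hξ n (by rw [← hcosh ξ hξ, hξp, hp])
    rw [le_div_iff₀ (by linarith)]
    linarith
  have hρ0 : 0 ≤ ρ := (norm_nonneg z).trans hz
  have hsubρ : Metric.closedBall (0 : ℂ) ρ ⊆ Metric.ball 0 1 := Metric.closedBall_subset_ball hρ
  have hz' : z ∈ Metric.closedBall (0 : ℂ) ρ := by simpa using hz
  have hmv : ‖h z - h 0‖ ≤ 288 / (1 - ρ) * ‖z - 0‖ :=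
    (convex_closedBall (0 : ℂ) ρ).norm_image_sub_le_of_norm_deriv_le
      (fun x hx => (hh x (hsubρ hx)).differentiableAt (Metric.isOpen_ball.mem_nhds (hsubρ hx)))
      hderiv (by simp [hρ0]) hz'
  have hhz : ‖h z‖ ≤ 6 + 288 / (1 - ρ) := by
    have h1 : 288 / (1 - ρ) * ‖z - 0‖ ≤ 288 / (1 - ρ) := by
      rw [sub_zero]
      exact mul_le_of_le_one_right (div_nonneg (by norm_num) (by linarith)) (by linarith)
    have := norm_sub_norm_le (h z) (h 0)
    linarith
  have hgz : ‖g z‖ ≤ Real.exp (6 + 288 / (1 - ρ)) ^ 2 := by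
    rw [← hcosh z (hsubρ hz'), norm_pow]
    gcongr
    exact (norm_ccosh_le _).trans (Real.exp_le_exp.2 hhz)
  rw [← hLF z (hsubρ hz')]
  refine (Complex.norm_exp_le_exp_norm _).trans (Real.exp_le_exp.2 ?_)
  rw [hLg, norm_mul, hn2pi, mul_comm]
  gcongr
  linarith

namespace RiemannSphere

theorem tanh_monotone : Monotone Real.tanh := by
  intro x y hxy
  rw [← Real.artanh_le_artanh_iff ⟨Real.neg_one_lt_tanh x, Real.tanh_lt_one x⟩
    ⟨Real.neg_one_lt_tanh y, Real.tanh_lt_one y⟩]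
  simpa only [Real.artanh_tanh] using hxy

/-- **Schottky's theorem** for the upper half plane with its hyperbolic distance: the disc version
is carried over by the Cayley transform centred at the base point. -/
theorem exists_schottky_bound_upperHalfPlane (D : ℝ) :
    ∃ C : ℝ, ∀ F : ℍ → ℂ, MDifferentiable 𝓘(ℂ) 𝓘(ℂ) F → (∀ τ, F τ ≠ 0) → (∀ τ, F τ ≠ 1) →
      ∀ a b : ℍ, dist a b ≤ D → 1 / 4 ≤ ‖F a‖ → ‖F a‖ ≤ 1 → ‖F b‖ ≤ C := by
  obtain ⟨C, hC⟩ := exists_schottky_bound (Real.tanh_lt_one (D / 2))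
  refine ⟨C, fun F hF hF0 hF1 a b hab hlow hupp => ?_⟩
  -- the Cayley transform of the disc centred at `a`
  let φ : ℂ → ℂ := fun ζ => (a - (starRingEnd ℂ) (a : ℂ) * ζ) / (1 - ζ)
  have hne : ∀ ζ ∈ Metric.ball (0 : ℂ) 1, 1 - ζ ≠ 0 := by
    intro ζ hζ h
    rw [mem_ball_zero_iff, ← sub_eq_zero.1 h] at hζ
    simp at hζ
  have him : ∀ ζ ∈ Metric.ball (0 : ℂ) 1, 0 < (φ ζ).im := by
    intro ζ hζ
    have hn : 0 < Complex.normSq (1 - ζ) := Complex.normSq_pos.2 (hne ζ hζ)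
    have h1 : ζ.re * ζ.re + ζ.im * ζ.im < 1 := by
      rw [← Complex.normSq_apply, Complex.normSq_eq_norm_sq]
      rw [mem_ball_zero_iff] at hζ
      nlinarith [norm_nonneg ζ]
    have : (φ ζ).im = (a : ℂ).im * (1 - (ζ.re * ζ.re + ζ.im * ζ.im)) / Complex.normSq (1 - ζ) := by
      simp only [φ, Complex.div_im]
      field_simp
      simp
      ring
    rw [this]
    exact div_pos (mul_pos a.im_pos (by linarith)) hn
  have hφd : DifferentiableOn ℂ φ (Metric.ball 0 1) := by
    intro ζ hζ
    have := hne ζ hζ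
    exact ((by fun_prop : DifferentiableAt ℂ (fun ζ : ℂ => (a : ℂ) - (starRingEnd ℂ) (a : ℂ) * ζ) ζ).div
      (by fun_prop) this).differentiableWithinAt
  have hFd : DifferentiableOn ℂ (fun w : ℂ => F (UpperHalfPlane.ofComplex w)) {z | 0 < z.im} :=
    UpperHalfPlane.mdifferentiable_iff.1 hF
  have hab' : (b : ℂ) - (starRingEnd ℂ) (a : ℂ) ≠ 0 := by
    intro h
    have h' := congrArg Complex.im h
    simp at h'
    linarith [a.im_pos, b.im_pos]
  let ζ : ℂ := ((b : ℂ) - a) / ((b : ℂ) - (starRingEnd ℂ) (a : ℂ))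
  have hζn : ‖ζ‖ = Real.tanh (dist b a / 2) := by
    rw [UpperHalfPlane.tanh_half_dist, norm_div, Complex.dist_eq, Complex.dist_eq]
  have hφζ : φ ζ = b := by
    have h1 : 1 - ζ ≠ 0 := hne ζ (mem_ball_zero_iff.2 (hζn.trans_lt (Real.tanh_lt_one _)))
    simp only [φ]
    rw [div_eq_iff h1]
    simp only [ζ]
    field_simp
    ring
  have hφ0 : φ 0 = a := by simp [φ]
  have key := hC (fun ζ => F (UpperHalfPlane.ofComplex (φ ζ))) (hFd.comp hφd him)
    (fun _ _ => hF0 _) (fun _ _ => hF1 _)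
    (by simpa only [hφ0, UpperHalfPlane.ofComplex_apply] using hlow)
    (by simpa only [hφ0, UpperHalfPlane.ofComplex_apply] using hupp) ζ
    (by rw [hζn]; exact tanh_monotone (by rw [dist_comm]; linarith))
  simpa only [hφζ, UpperHalfPlane.ofComplex_apply] using key

/-! ### Möbius maps and the Poincaré distance -/

/-- The Möbius map `z ↦ c * (z - p) / (z - s)` of the sphere, with values in `ℂ`: its value at `∞`
is `c`, and at its pole `s` it takes the junk value `0`. -/
noncomputable def mobius (c p s : ℂ) : RiemannSphere → ℂ :=
  fun z => OnePoint.elim z c (fun w => c * (w - p) / (w - s))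

@[simp] theorem mobius_infty (c p s : ℂ) : mobius c p s OnePoint.infty = c := rfl

@[simp] theorem mobius_coe (c p s z : ℂ) :
    mobius c p s (z : RiemannSphere) = c * (z - p) / (z - s) := rfl

theorem affineChart_mem_atlas : affineChart ∈ atlas ℂ RiemannSphere := Or.inl rfl

theorem chartAtInfty_mem_atlas : chartAtInfty ∈ atlas ℂ RiemannSphere := Or.inr rfl

theorem mdifferentiableAt_mobius (c p s : ℂ) {z : RiemannSphere}
    (hz : z ≠ (s : RiemannSphere)) : MDifferentiableAt 𝓘(ℂ) 𝓘(ℂ) (mobius c p s) z := by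
  induction z using OnePoint.rec with
  | infty =>
    have hsrc : (OnePoint.infty : RiemannSphere) ∈ chartAtInfty.source :=
      mem_chartAtInfty_source.2 (OnePoint.infty_ne_coe 0)
    have h1 : MDifferentiableAt 𝓘(ℂ) 𝓘(ℂ) chartAtInfty (OnePoint.infty : RiemannSphere) :=
      mdifferentiableAt_atlas chartAtInfty_mem_atlas hsrc
    have h2 : MDifferentiableAt 𝓘(ℂ) 𝓘(ℂ) (fun w : ℂ => c * (1 - p * w) / (1 - s * w))
        (chartAtInfty (OnePoint.infty : RiemannSphere)) := by
      apply DifferentiableAt.mdifferentiableAt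
      apply DifferentiableAt.div (by fun_prop) (by fun_prop)
      simp
    refine (h2.comp _ h1).congr_of_eventuallyEq ?_
    filter_upwards [chartAtInfty.open_source.mem_nhds hsrc] with w hw
    induction w using OnePoint.rec with
    | infty => simp
    | coe w =>
      have hw0 : w ≠ 0 := by
        rintro rfl
        exact mem_chartAtInfty_source.1 hw rfl
      simp only [mobius_coe, Function.comp_apply, chartAtInfty_apply, affineChart_invFun_coe w hw0]
      rw [← mul_div_mul_right (c * (w - p)) (w - s) (inv_ne_zero hw0)]
      congr 1 <;> field_simp
  | coe z =>
    have hsrc : (z : RiemannSphere) ∈ affineChart.source := by simp [affineChart_source]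
    have h1 : MDifferentiableAt 𝓘(ℂ) 𝓘(ℂ) affineChart (z : RiemannSphere) :=
      mdifferentiableAt_atlas affineChart_mem_atlas hsrc
    have hzs : z - s ≠ 0 := by
      intro h
      exact hz (by rw [sub_eq_zero.1 h])
    have h2 : MDifferentiableAt 𝓘(ℂ) 𝓘(ℂ) (fun w : ℂ => c * (w - p) / (w - s))
        (affineChart (z : RiemannSphere)) := by
      apply DifferentiableAt.mdifferentiableAt
      apply DifferentiableAt.div (by fun_prop) (by fun_prop)
      simpa using hzs
    refine (h2.comp _ h1).congr_of_eventuallyEq ?_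
    filter_upwards [affineChart.open_source.mem_nhds hsrc] with w hw
    induction w using OnePoint.rec with
    | infty => simp [affineChart_source] at hw
    | coe w => simp

theorem mdifferentiable_invFun : MDifferentiable 𝓘(ℂ) 𝓘(ℂ) invFun := by
  intro z
  induction z using OnePoint.rec with
  | infty =>
    have hsrc : (OnePoint.infty : RiemannSphere) ∈ chartAtInfty.source :=
      mem_chartAtInfty_source.2 (OnePoint.infty_ne_coe 0)
    refine ((mdifferentiableAt_atlas_symm (I := 𝓘(ℂ)) affineChart_mem_atlas
      (mem_univ _)).comp _ (mdifferentiableAt_atlas (I := 𝓘(ℂ)) chartAtInfty_mem_atlas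
        hsrc)).congr_of_eventuallyEq ?_
    filter_upwards [chartAtInfty.open_source.mem_nhds hsrc] with w hw
    exact (affineChart.left_inv hw).symm
  | coe z =>
    have hsrc : (z : RiemannSphere) ∈ affineChart.source := by simp [affineChart_source]
    refine ((mdifferentiableAt_atlas_symm (I := 𝓘(ℂ)) chartAtInfty_mem_atlas
      (mem_univ _)).comp _ (mdifferentiableAt_atlas (I := 𝓘(ℂ)) affineChart_mem_atlas
        hsrc)).congr_of_eventuallyEq ?_
    filter_upwards [affineChart.open_source.mem_nhds hsrc] with w hw
    exact congrArg invFun (affineChart.left_inv hw).symm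

/-- The Poincaré distance does not increase under the inversion (and so, the inversion being an
involution, it is invariant). -/
theorem poincareEDist_preimage_invFun_le (Ω : Set RiemannSphere) (z w : RiemannSphere) :
    poincareEDist (invFun ⁻¹' Ω) (invFun z) (invFun w) ≤ poincareEDist Ω z w := by
  simp only [poincareEDist, le_iInf_iff]
  intro f hf hfΩ a b ha hb
  exact iInf₂_le_of_le (invFun ∘ f) (mdifferentiable_invFun.comp hf) <|
    iInf₂_le_of_le (fun τ => by simpa [invFun_invFun] using hfΩ τ) a <|
    iInf₂_le_of_le b (by simp [ha]) <| iInf_le_of_le (by simp [hb]) le_rfl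

/-- The metric estimate: `s`, `p`, `q` are points of `K`, where `p` and `q` lie on opposite sides of
`z` at distance about `4 * ε * ‖z - s‖` from it. Then a point at bounded Poincaré distance
from `z` is at Euclidean distance `O(ε) * ‖z - s‖` from `z`. The Möbius map sending `p`, `q`, `s` to
`0`, `1`, `∞` turns a holomorphic map into the complement of `K` into a function to which
Schottky's theorem applies. -/
theorem exists_norm_sub_le_of_poincareEDist_le (M : ℝ≥0) :
    ∃ C : ℝ, 0 < C ∧ ∀ (K : Set RiemannSphere) (s p q z : ℂ) (w : RiemannSphere) (ε : ℝ),
      (s : RiemannSphere) ∈ K → (p : RiemannSphere) ∈ K → (q : RiemannSphere) ∈ K →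
      0 < ε → ε * C ≤ 1 → z ≠ s →
      dist p (z + 4 * (ε * ‖z - s‖ : ℝ)) ≤ ε * ‖z - s‖ →
      dist q (z - 4 * (ε * ‖z - s‖ : ℝ)) ≤ ε * ‖z - s‖ →
      poincareEDist Kᶜ w z ≤ M → ∃ v : ℂ, w = v ∧ ‖v - z‖ ≤ C * ε * ‖z - s‖ := by
  obtain ⟨C₀, hC₀⟩ := exists_schottky_bound_upperHalfPlane (M + 1)
  set C := max C₀ 2 with hCdef
  have hC2 : 2 ≤ C := le_max_right _ _
  refine ⟨33 * C, by positivity, ?_⟩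
  intro K s p q z w ε hs hp hq hε hεC hzs hpd hqd hdist
  set r := ‖z - s‖ with hr
  have hrpos : 0 < r := norm_pos_iff.2 (sub_ne_zero.2 hzs)
  have hεr : 0 < ε * r := by positivity
  have hε30 : ε ≤ 1 / 66 := by nlinarith
  have hεr30 : ε * r ≤ r / 66 := by nlinarith
  -- the configuration of the points `s`, `p`, `q`, `z`
  set d : ℂ := ((ε * r : ℝ) : ℂ) with hd
  have hdn : ‖d‖ = ε * r := by rw [hd, Complex.norm_real, Real.norm_of_nonneg hεr.le]
  have h4d : ‖4 * d‖ = 4 * (ε * r) := by rw [norm_mul, hdn]; norm_num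
  have h8d : ‖8 * d‖ = 8 * (ε * r) := by rw [norm_mul, hdn]; norm_num
  rw [dist_eq_norm] at hpd hqd
  have hzp : 3 * (ε * r) ≤ ‖z - p‖ ∧ ‖z - p‖ ≤ 5 * (ε * r) := by
    have h1 := norm_sub_norm_le (4 * d) (-(p - (z + 4 * d)))
    have h2 := norm_add_le (4 * d) (p - (z + 4 * d))
    rw [norm_neg] at h1
    rw [show 4 * d - -(p - (z + 4 * d)) = -(z - p) by ring, norm_neg] at h1
    rw [show 4 * d + (p - (z + 4 * d)) = -(z - p) by ring, norm_neg] at h2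
    constructor <;> linarith
  have hzq : ‖z - q‖ ≤ 5 * (ε * r) := by
    have h2 := norm_sub_le (4 * d) (q - (z - 4 * d))
    rw [show 4 * d - (q - (z - 4 * d)) = z - q by ring] at h2
    linarith
  have hqp : 6 * (ε * r) ≤ ‖q - p‖ ∧ ‖q - p‖ ≤ 10 * (ε * r) := by
    have h0 := norm_sub_le (p - (z + 4 * d)) (q - (z - 4 * d))
    have h1 := norm_sub_norm_le (8 * d) (-((p - (z + 4 * d)) - (q - (z - 4 * d))))
    rw [norm_neg] at h1
    rw [show 8 * d - -((p - (z + 4 * d)) - (q - (z - 4 * d))) = -(q - p) by ring, norm_neg] at h1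
    have h2 := norm_sub_le (z - p) (z - q)
    rw [show z - p - (z - q) = q - p by ring] at h2
    constructor <;> linarith
  have hqs : 5 / 6 * r ≤ ‖q - s‖ ∧ ‖q - s‖ ≤ 7 / 6 * r := by
    have h1 := norm_sub_norm_le (z - s) (z - q)
    have h2 := norm_sub_le (z - s) (z - q)
    rw [show z - s - (z - q) = q - s by ring] at h1 h2
    constructor <;> linarith
  have hps : 5 / 6 * r ≤ ‖p - s‖ ∧ ‖p - s‖ ≤ 7 / 6 * r := by
    have h1 := norm_sub_norm_le (z - s) (z - p)
    have h2 := norm_sub_le (z - s) (z - p)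
    rw [show z - s - (z - p) = p - s by ring] at h1 h2
    constructor <;> linarith [hzp.2]
  have hqpne : q - p ≠ 0 := norm_pos_iff.1 (by linarith [hqp.1])
  have hqsne : q - s ≠ 0 := norm_pos_iff.1 (by linarith [hqs.1])
  have hpsne : p - s ≠ 0 := norm_pos_iff.1 (by linarith [hps.1])
  -- the Möbius map sending `p`, `q`, `s` to `0`, `1`, `∞`
  set c : ℂ := (q - s) / (q - p) with hc
  have hc0 : c ≠ 0 := div_ne_zero hqsne hqpne
  have hcn : ‖c‖ = ‖q - s‖ / ‖q - p‖ := norm_div _ _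
  have hT0 : ∀ x : RiemannSphere, x ∈ Kᶜ → mobius c p s x ≠ 0 := by
    intro x hx
    induction x using OnePoint.rec with
    | infty => simpa using hc0
    | coe x =>
      have h1 : x - p ≠ 0 := fun h => hx (by rwa [sub_eq_zero.1 h])
      have h2 : x - s ≠ 0 := fun h => hx (by rwa [sub_eq_zero.1 h])
      exact div_ne_zero (mul_ne_zero hc0 h1) h2
  have hT1 : ∀ x : RiemannSphere, x ∈ Kᶜ → mobius c p s x ≠ 1 := by
    intro x hx h
    induction x using OnePoint.rec with
    | infty =>
      rw [mobius_infty, hc, div_eq_one_iff_eq hqpne] at h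
      exact hpsne (by linear_combination h)
    | coe x =>
      have h1 : x - q ≠ 0 := fun h => hx (by rwa [sub_eq_zero.1 h])
      have h2 : x - s ≠ 0 := fun h => hx (by rwa [sub_eq_zero.1 h])
      rw [mobius_coe, div_eq_one_iff_eq h2, hc, div_mul_eq_mul_div, div_eq_iff hqpne] at h
      exact mul_ne_zero h1 hpsne (by linear_combination h)
  have hTz : ‖mobius c p s (z : RiemannSphere)‖ = ‖q - s‖ * ‖z - p‖ / (‖q - p‖ * r) := by
    rw [mobius_coe, norm_div, norm_mul, hcn, ← hr]
    field_simp
  have hden : 0 < ‖q - p‖ * r := mul_pos (norm_pos_iff.2 hqpne) hrpos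
  have hlow : 1 / 4 ≤ ‖mobius c p s (z : RiemannSphere)‖ := by
    rw [hTz, le_div_iff₀ hden]
    calc 1 / 4 * (‖q - p‖ * r) ≤ 1 / 4 * (10 * (ε * r) * r) := by gcongr; exact hqp.2
      _ = (5 / 6 * r) * (3 * (ε * r)) := by ring
      _ ≤ ‖q - s‖ * ‖z - p‖ := by gcongr; exacts [hqs.1, hzp.1]
  have hupp : ‖mobius c p s (z : RiemannSphere)‖ ≤ 1 := by
    rw [hTz, div_le_one hden]
    calc ‖q - s‖ * ‖z - p‖ ≤ (7 / 6 * r) * (5 * (ε * r)) := by gcongr; exacts [hqs.2, hzp.2]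
      _ ≤ (6 * (ε * r)) * r := by nlinarith
      _ ≤ ‖q - p‖ * r := by gcongr; exact hqp.1
  -- a holomorphic map `f : ℍ → Ω` almost realizing the distance
  have hlt : poincareEDist Kᶜ w z < (M : ENNReal) + 1 :=
    hdist.trans_lt (ENNReal.lt_add_right ENNReal.coe_ne_top one_ne_zero)
  simp only [poincareEDist, iInf_lt_iff] at hlt
  obtain ⟨f, hf, hfK, a, b, ha, hb, hab⟩ := hlt
  have hab' : dist b a ≤ M + 1 := by
    rw [dist_comm, dist_edist]
    have h1 := ENNReal.toReal_mono (by simp) hab.le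
    rwa [ENNReal.toReal_add ENNReal.coe_ne_top ENNReal.one_ne_top, ENNReal.coe_toReal,
      ENNReal.toReal_one] at h1
  have hTw : ‖mobius c p s w‖ ≤ C := by
    have h1 := hC₀ (mobius c p s ∘ f)
      (fun τ => (mdifferentiableAt_mobius c p s
        (fun h => hfK τ (by rw [h]; exact hs))).comp τ (hf τ))
      (fun τ => hT0 _ (hfK τ)) (fun τ => hT1 _ (hfK τ)) b a hab'
      (by simpa only [Function.comp_apply, hb] using hlow)
      (by simpa only [Function.comp_apply, hb] using hupp)
    rw [Function.comp_apply, ha] at h1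
    exact h1.trans (le_max_left _ _)
  have hwK : w ∈ Kᶜ := ha ▸ hfK a
  -- `‖c‖` is of order at least `1 / ε`, and so exceeds `C`
  have hclow : 1 ≤ 12 * ε * ‖c‖ := by
    rw [hcn, ← mul_div_assoc, le_div_iff₀ (norm_pos_iff.2 hqpne), one_mul]
    calc ‖q - p‖ ≤ 10 * (ε * r) := hqp.2
      _ = 12 * ε * (5 / 6 * r) := by ring
      _ ≤ 12 * ε * ‖q - s‖ := by gcongr; exact hqs.1
  induction w using OnePoint.rec with
  | infty =>
    exfalso
    rw [mobius_infty] at hTw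
    nlinarith
  | coe v =>
    refine ⟨v, rfl, ?_⟩
    have hvs : v - s ≠ 0 := fun h => hwK (by rwa [sub_eq_zero.1 h])
    rw [mobius_coe, norm_div, norm_mul, div_le_iff₀ (norm_pos_iff.2 hvs)] at hTw
    have h1 : ‖v - p‖ ≤ 12 * ε * C * ‖v - s‖ := by
      calc ‖v - p‖ = 1 * ‖v - p‖ := (one_mul _).symm
        _ ≤ 12 * ε * ‖c‖ * ‖v - p‖ := by gcongr
        _ = 12 * ε * (‖c‖ * ‖v - p‖) := by ring
        _ ≤ 12 * ε * (C * ‖v - s‖) := by gcongr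
        _ = _ := by ring
    have h2 : ‖v - s‖ ≤ ‖v - p‖ + ‖p - s‖ := by
      have := norm_add_le (v - p) (p - s)
      rwa [sub_add_sub_cancel] at this
    have h3 : 12 * ε * C ≤ 1 / 2 := by linarith
    have h4 : ‖v - p‖ ≤ 28 * ε * C * r := by
      have h5 : 12 * ε * C * ‖v - s‖ ≤ 12 * ε * C * (‖v - p‖ + ‖p - s‖) := by gcongr
      have h6 : 12 * ε * C * ‖v - p‖ ≤ 1 / 2 * ‖v - p‖ := by gcongr
      have h7 : 12 * ε * C * ‖p - s‖ ≤ 12 * ε * C * (7 / 6 * r) := by gcongr; exact hps.2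
      linarith
    have h5 : ‖v - z‖ ≤ ‖v - p‖ + ‖z - p‖ := by
      have := norm_sub_le (v - p) (z - p)
      rwa [sub_sub_sub_cancel_right] at this
    have h6 : 5 * (ε * r) ≤ 5 * (C * (ε * r)) := by
      have : 1 * (ε * r) ≤ C * (ε * r) := by gcongr; linarith
      linarith
    linarith [hzp.2]

end RiemannSphere

/-! ### Density points -/

/-- Near a density point `x`, the set `A` meets every disc of radius `ε * r` inside the disc of
radius `2 * r` about `x`: otherwise the proportion `(ε / 2) ^ 2` of the larger disc would be
missing from `A`. -/
theorem eventually_forall_exists_mem_dist_lt_of_density {A : Set ℂ} {x : ℂ}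
    (hA : Tendsto (fun r : ℝ => volume (Metric.ball x r ∩ A) / volume (Metric.ball x r))
      (𝓝[>] 0) (𝓝 1)) {ε : ℝ} (hε : 0 < ε) :
    ∀ᶠ r in 𝓝[>] (0 : ℝ), ∀ y, dist y x + ε * r ≤ 2 * r → ∃ p ∈ A, dist p y < ε * r := by
  have h2 : Tendsto (fun r : ℝ => 2 * r) (𝓝[>] 0) (𝓝[>] 0) := by
    refine tendsto_nhdsWithin_iff.2 ⟨?_, ?_⟩
    · have : Tendsto (fun r : ℝ => 2 * r) (𝓝 0) (𝓝 (2 * 0)) :=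
        (continuous_const_mul (2 : ℝ)).tendsto 0
      rw [mul_zero] at this
      exact this.mono_left nhdsWithin_le_nhds
    · filter_upwards [self_mem_nhdsWithin] with r hr
      exact mul_pos two_pos (mem_Ioi.1 hr)
  have hlt : 1 - ENNReal.ofReal (ε / 2) ^ 2 < 1 :=
    ENNReal.sub_lt_self ENNReal.one_ne_top one_ne_zero (by simp [hε])
  filter_upwards [(hA.comp h2).eventually_const_lt hlt, self_mem_nhdsWithin] with r hr hr0
  intro y hy
  have hr0 : 0 < r := hr0
  by_contra! hne
  have hsub : Metric.ball x (2 * r) ∩ A ⊆ Metric.ball x (2 * r) \ Metric.ball y (ε * r) :=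
    fun p hp => ⟨hp.1, fun h => (hne p hp.2).not_gt h⟩
  have hV : volume (Metric.ball y (ε * r))
      = ENNReal.ofReal (ε / 2) ^ 2 * volume (Metric.ball x (2 * r)) := by
    rw [Complex.volume_ball, Complex.volume_ball, ← mul_assoc, ← mul_pow,
      ← ENNReal.ofReal_mul (by positivity)]
    congr 3
    ring
  have hV0 : volume (Metric.ball x (2 * r)) ≠ 0 := (Metric.measure_ball_pos _ _ (by positivity)).ne'
  have hVtop : volume (Metric.ball x (2 * r)) ≠ ⊤ := measure_ball_lt_top.ne
  refine hr.not_ge ?_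
  simp only [Function.comp_apply]
  rw [ENNReal.div_le_iff hV0 hVtop, ENNReal.sub_mul (fun _ _ => hVtop), one_mul, ← hV,
    ← measure_sdiff (Metric.ball_subset_ball' (by linarith))
      measurableSet_ball.nullMeasurableSet measure_ball_lt_top.ne]
  exact measure_mono hsub

namespace RiemannSphere

/-- The displacement of `l` is `o(‖z - x‖)` at a finite density point `x`. -/
theorem hasFDerivAt_of_poincareEDist_le {K : Set RiemannSphere} {l : RiemannSphere → RiemannSphere}
    (hl_id : ∀ z ∈ K, l z = z) {M : ℝ≥0} (hl_bdd : ∀ z ∈ Kᶜ, poincareEDist Kᶜ (l z) z ≤ M)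
    {x : ℂ} (hx : (x : RiemannSphere) ∈ K)
    (hdens : Tendsto (fun r : ℝ =>
      volume (Metric.ball x r ∩ (fun z : ℂ => (z : RiemannSphere)) ⁻¹' K) / volume (Metric.ball x r))
      (𝓝[>] 0) (𝓝 1)) :
    HasFDerivAt (fun z : ℂ => affineChart (l (z : RiemannSphere))) (ContinuousLinearMap.id ℝ ℂ) x := by
  obtain ⟨C, hC, hmain⟩ := exists_norm_sub_le_of_poincareEDist_le M
  rw [hasFDerivAt_iff_isLittleO, Asymptotics.isLittleO_iff]
  intro η hη
  set ε := min (1 / 5) (min (1 / C) (η / C)) with hε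
  have hεpos : 0 < ε := by positivity
  have hε5 : ε ≤ 1 / 5 := min_le_left _ _
  have hεC : ε * C ≤ 1 := by
    rw [← le_div_iff₀ hC]; exact (min_le_right _ _).trans (min_le_left _ _)
  have hεη : ε * C ≤ η := by
    rw [← le_div_iff₀ hC]; exact (min_le_right _ _).trans (min_le_right _ _)
  have hev := eventually_forall_exists_mem_dist_lt_of_density hdens hεpos
  rw [eventually_nhdsWithin_iff] at hev
  have hnorm : Tendsto (fun z : ℂ => ‖z - x‖) (𝓝 x) (𝓝 0) := by
    have : Tendsto (fun z : ℂ => ‖z - x‖) (𝓝 x) (𝓝 ‖x - x‖) :=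
      (by fun_prop : Continuous fun z : ℂ => ‖z - x‖).tendsto x
    simpa using this
  filter_upwards [hnorm.eventually hev] with z hz
  simp only [hl_id _ hx, affineChart_coe, ContinuousLinearMap.id_apply, sub_sub_sub_cancel_right]
  by_cases hzK : (z : RiemannSphere) ∈ K
  · rw [hl_id _ hzK, affineChart_coe, sub_self, norm_zero]
    positivity
  have hzx : z ≠ x := by
    rintro rfl
    exact hzK hx
  have hr : 0 < ‖z - x‖ := norm_pos_iff.2 (sub_ne_zero.2 hzx)
  have hd : ‖(4 * (ε * ‖z - x‖ : ℝ) : ℂ)‖ = 4 * (ε * ‖z - x‖) := by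
    rw [norm_mul, Complex.norm_real, Real.norm_of_nonneg (by positivity)]
    norm_num
  have hεr : ε * ‖z - x‖ ≤ 1 / 5 * ‖z - x‖ := by gcongr
  obtain ⟨p, hpK, hp⟩ := hz hr (z + 4 * (ε * ‖z - x‖ : ℝ)) (by
    have := norm_add_le (z - x) (4 * (ε * ‖z - x‖ : ℝ) : ℂ)
    rw [dist_eq_norm, add_sub_right_comm]
    linarith)
  obtain ⟨q, hqK, hq⟩ := hz hr (z - 4 * (ε * ‖z - x‖ : ℝ)) (by
    have := norm_sub_le (z - x) (4 * (ε * ‖z - x‖ : ℝ) : ℂ)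
    rw [dist_eq_norm, sub_right_comm]
    linarith)
  obtain ⟨v, hv, hvz⟩ := hmain K x p q z (l z) ε hx hpK hqK hεpos hεC hzx hp.le hq.le (hl_bdd _ hzK)
  rw [hv, affineChart_coe]
  refine hvz.trans ?_
  rw [mul_comm C]
  gcongr

theorem hasMFDerivAt_of_isLebesgueDensityPoint {K : Set RiemannSphere}
    {l : RiemannSphere → RiemannSphere} (hl : Continuous l) (hl_id : ∀ z ∈ K, l z = z) {M : ℝ≥0}
    (hl_bdd : ∀ z ∈ Kᶜ, poincareEDist Kᶜ (l z) z ≤ M) {z : RiemannSphere} (hz : z ∈ K)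
    (hdens : IsLebesgueDensityPoint K z) :
    HasMFDerivAt 𝓘(ℝ, ℂ) 𝓘(ℝ, ℂ) l z (ContinuousLinearMap.id ℝ ℂ) := by
  refine ⟨hl.continuousAt, ?_⟩
  suffices h : HasFDerivAt (𝕜 := ℝ) (E := ℂ) (F := ℂ)
      (writtenInExtChartAt 𝓘(ℝ, ℂ) 𝓘(ℝ, ℂ) z l) (ContinuousLinearMap.id ℝ ℂ)
      (extChartAt 𝓘(ℝ, ℂ) z z) from h.hasFDerivWithinAt
  induction z using OnePoint.rec with
  -- at `∞`, conjugation by the inversion reduces the claim to the density point `0`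
  | infty =>
    have h0 : ((0 : ℂ) : RiemannSphere) ∈ invFun ⁻¹' K := by simpa [invFun_coe] using hz
    have h1 : IsLebesgueDensityPoint K OnePoint.infty := hdens
    unfold IsLebesgueDensityPoint at h1
    have hchart : chartAt ℂ (OnePoint.infty : RiemannSphere) OnePoint.infty = 0 := by
      rw [chartAt_infty, chartAtInfty_apply, invFun_infty, affineChart_coe]
    rw [hchart] at h1
    have key := hasFDerivAt_of_poincareEDist_le (K := invFun ⁻¹' K) (l := invFun ∘ l ∘ invFun)
      (fun z hz => by simp [hl_id _ hz, invFun_invFun]) (M := M)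
      (fun z hz => by
        have h2 := poincareEDist_preimage_invFun_le Kᶜ (l (invFun z)) (invFun z)
        rw [invFun_invFun] at h2
        exact h2.trans (hl_bdd _ hz)) h0 h1
    have hw : writtenInExtChartAt 𝓘(ℝ, ℂ) 𝓘(ℝ, ℂ) (OnePoint.infty : RiemannSphere) l
        = fun z : ℂ => affineChart ((invFun ∘ l ∘ invFun) (z : RiemannSphere)) := by
      funext w
      simp only [writtenInExtChartAt, hl_id _ hz, extChartAt, chartAt_infty]
      rfl
    rw [hw, show extChartAt 𝓘(ℝ, ℂ) (OnePoint.infty : RiemannSphere) OnePoint.infty = 0 from hchart]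
    exact key
  | coe x =>
    have hchart : chartAt ℂ (x : RiemannSphere) x = x := by rw [chartAt_coe, affineChart_coe]
    have h1 : IsLebesgueDensityPoint K x := hdens
    unfold IsLebesgueDensityPoint at h1
    rw [hchart] at h1
    have key := hasFDerivAt_of_poincareEDist_le hl_id hl_bdd hz h1
    have hw : writtenInExtChartAt 𝓘(ℝ, ℂ) 𝓘(ℝ, ℂ) (x : RiemannSphere) l
        = fun z : ℂ => affineChart (l (z : RiemannSphere)) := by
      funext w
      simp only [writtenInExtChartAt, hl_id _ hz, extChartAt, chartAt_coe]
      rfl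
    rw [hw, show extChartAt 𝓘(ℝ, ℂ) (x : RiemannSphere) x = x from hchart]
    exact key

/-- The Lebesgue density theorem for the sphere; open and closed discs are interchangeable
because circles are null sets. -/
theorem ae_isLebesgueDensityPoint {K : Set RiemannSphere} (hK : IsClosed K) :
    ∀ᵐ z : ℂ ∂volume, (z : RiemannSphere) ∈ K → IsLebesgueDensityPoint K (z : RiemannSphere) := by
  set A : Set ℂ := (fun z : ℂ => (z : RiemannSphere)) ⁻¹' K with hA
  have hAm : MeasurableSet A := (hK.preimage OnePoint.continuous_coe).measurableSet
  filter_upwards [(ae_restrict_iff' hAm).1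
    (Besicovitch.ae_tendsto_measure_inter_div (volume : Measure ℂ) A)] with z hz hzK
  refine (hz hzK).congr fun r => ?_
  change _ = volume (Metric.ball (chartAt ℂ (z : RiemannSphere) z) r ∩ A) /
    volume (Metric.ball (chartAt ℂ (z : RiemannSphere) z) r)
  rw [chartAt_coe, affineChart_coe, inter_comm A]
  have hae : Metric.ball z r =ᵐ[volume] Metric.closedBall z r := by
    rw [← Metric.ball_union_sphere]
    exact (union_ae_eq_left_of_ae_eq_empty
      (ae_eq_empty.2 (Measure.addHaar_sphere volume z r))).symm
  rw [measure_congr hae, measure_congr (hae.inter (ae_eq_refl A))]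

end RiemannSphere

theorem mainTheorem11 (K : Set RiemannSphere) (hK_compact : IsCompact K)
    (hK_conn : IsConnected K) (hK_full : IsPreconnected Kᶜ)
    (l : RiemannSphere ≃ₜ RiemannSphere) (hl_id : ∀ z ∈ K, l z = z)
    (M : ℝ≥0) (hl_bdd : ∀ z ∈ Kᶜ, RiemannSphere.poincareEDist Kᶜ (l z) z ≤ M) :
    (∀ᵐ z : ℂ ∂volume, (z : RiemannSphere) ∈ K →
        MDifferentiableAt 𝓘(ℝ, ℂ) 𝓘(ℝ, ℂ) l (z : RiemannSphere)) ∧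
      ∀ z ∈ K, RiemannSphere.IsLebesgueDensityPoint K z →
        HasMFDerivAt 𝓘(ℝ, ℂ) 𝓘(ℝ, ℂ) l z (ContinuousLinearMap.id ℝ ℂ) := by
  have h : ∀ z ∈ K, RiemannSphere.IsLebesgueDensityPoint K z →
      HasMFDerivAt 𝓘(ℝ, ℂ) 𝓘(ℝ, ℂ) l z (ContinuousLinearMap.id ℝ ℂ) := fun z hz hdens =>
    RiemannSphere.hasMFDerivAt_of_isLebesgueDensityPoint l.continuous hl_id hl_bdd hz hdens
  refine ⟨?_, h⟩
  filter_upwards [RiemannSphere.ae_isLebesgueDensityPoint hK_compact.isClosed] with z hz hzK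
  exact (h z hzK (hz hzK)).mdifferentiableAt
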